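/- Let $k$ be an algebraically closed field and let $A$ be an associative unital $k$-algebra which is left and right Noetherian. Let $\mathrm{rad}A$ be its Jacobson radical. Assume that $A$ is semiperfect (that is, $A/\mathrm{rad}A$ is semisimple and idempotents lift modulo $\mathrm{rad}A$), that $A$ is basic (that is, $A/\mathrm{rad}A$ is a finite product of division rings), and that $A/\mathrm{rad}A$ is finite dimensional over $k$. Let $e\in A$ be a primitive idempotent, let $S_e=eA/e\,\mathrm{rad}A$ be the corresponding simple right $A$-module, and let $\Gamma=(1-e)A(1-e)$, a ring with identity $1-e$. Suppose that $\mathrm{Ext}^1_A(S_e,S_e)=0$. If the global dimensions of $A$ and of $\Gamma$ are both finite, then $S_e$ is self-orthogonal, that is, $\mathrm{Ext}^i_A(S_e,S_e)=0$ for all integers $i>0$. -/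

import Mathlib

open CategoryTheory MulOpposite

universe u

/-- Semiperfect ring: `A / rad A` is semisimple and idempotents lift modulo `rad A`. -/
structure IsSemiperfectRing (A : Type u) [Ring A] : Prop where
  semisimple : IsSemisimpleRing (A ⧸ Ring.jacobson A)
  lift_idempotent : ∀ x : A ⧸ Ring.jacobson A, IsIdempotentElem x →
    ∃ f : A, IsIdempotentElem f ∧ Ideal.Quotient.mk (Ring.jacobson A) f = x

/-- Basic (semiperfect) ring: in the Wedderburn decomposition of `A / rad A` all matrix blocks
have size one, that is, `A / rad A` is a finite product of division rings. -/
def IsBasicRing (A : Type u) [Ring A] : Prop :=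
  ∃ (n : ℕ) (D : Fin n → Type u) (_ : ∀ i, DivisionRing (D i)),
    Nonempty ((A ⧸ Ring.jacobson A) ≃+* (∀ i, D i))

/-- Primitive idempotent: a nonzero idempotent which is not the sum of two nonzero orthogonal
idempotents. -/
structure IsPrimitiveIdempotent {A : Type u} [Ring A] (e : A) : Prop where
  idem : IsIdempotentElem e
  ne_zero : e ≠ 0
  eq_zero_or_eq_zero : ∀ f g : A, IsIdempotentElem f → IsIdempotentElem g →
    f * g = 0 → g * f = 0 → e = f + g → f = 0 ∨ g = 0

/-- Right `A`-modules are left modules over the opposite ring `Aᵐᵒᵖ`. -/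
abbrev RightModuleCat (A : Type u) [Ring A] := ModuleCat.{u} Aᵐᵒᵖ

/-- The right ideal `eA`. -/
def idempotentIdeal {A : Type u} [Ring A] (e : A) : Submodule Aᵐᵒᵖ A where
  carrier := {x | ∃ a : A, x = e * a}
  zero_mem' := ⟨0, by simp⟩
  add_mem' := by
    rintro _ _ ⟨a, rfl⟩ ⟨b, rfl⟩
    exact ⟨a + b, by rw [mul_add]⟩
  smul_mem' := by
    rintro r _ ⟨a, rfl⟩
    exact ⟨a * r.unop, by rw [MulOpposite.smul_eq_mul_unop, mul_assoc]⟩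

/-- The right ideal `e rad A`. -/
def idempotentRad {A : Type u} [Ring A] (e : A) : Submodule Aᵐᵒᵖ A where
  carrier := {x | ∃ a ∈ Ring.jacobson A, x = e * a}
  zero_mem' := ⟨0, Submodule.zero_mem _, by simp⟩
  add_mem' := by
    rintro _ _ ⟨a, ha, rfl⟩ ⟨b, hb, rfl⟩
    exact ⟨a + b, Submodule.add_mem _ ha hb, by rw [mul_add]⟩
  smul_mem' := by
    rintro r _ ⟨a, ha, rfl⟩
    exact ⟨a * r.unop, Ideal.mul_mem_right _ _ ha, by
      rw [MulOpposite.smul_eq_mul_unop, mul_assoc]⟩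

/-- The right `A`-module `S_e = eA / e rad A`. -/
def simpleTop {A : Type u} [Ring A] (e : A) : RightModuleCat A :=
  ModuleCat.of Aᵐᵒᵖ (idempotentIdeal e ⧸ (idempotentRad e).submoduleOf (idempotentIdeal e))

/-- The (right) global dimension: the supremum of the projective dimensions of all right
modules. For rings that are left and right Noetherian it agrees with the left one. -/
noncomputable def globalDimension (A : Type u) [Ring A] : WithBot ℕ∞ :=
  ⨆ M : RightModuleCat A, projectiveDimension M

/-- `M` is self-orthogonal if `Ext^i_A(M, M) = 0` for all `i > 0`. -/
def IsSelfOrthogonal {A : Type u} [Ring A] (M : RightModuleCat A) : Prop :=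
  ∀ i : ℕ, 0 < i → Subsingleton (Abelian.Ext M M i)

/-- The idempotent subalgebra `Γ = (1 - e) A (1 - e)`, a ring with identity `1 - e`. -/
abbrev IdempotentSubalgebra {A : Type u} [Ring A] {e : A} (he : IsIdempotentElem e) : Type u :=
  he.one_sub.Corner

/-!
The proof works with the idempotent `f = 1 - e` and the exact functor `M ↦ M f` from right
`A`-modules to right `Γ`-modules. Write `S = S_e`.

The modules `T` with `T f = 0` are exactly the direct sums of copies of `S`
(`nonempty_linearEquiv_finsupp_of_op_one_sub_smul`). Since `A` is basic, `S f = 0`. Conversely,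
the vanishing of `Ext¹(S, S)` and Nakayama's lemma give `e rad A ⊆ e A f A`
(`submoduleOf_idempotentRad_le_span`), so that the radical kills `T`, and then every nonzero
element of `T` generates a copy of `S`.

As `A` has finite global dimension, there is a top degree `n` with `Ext^n(S, S) ≠ 0`; by the
previous paragraph it is also the top degree of `Ext(T, S)` for every nonzero `T` with `T f = 0`.
The main step `ext_eq_zero_or_exists_ge` says that a module `M` for which `M f` has finite
projective dimension over `Γ` either has `Ext(M, S) = 0` in all degrees, or has `Ext^i(M, S) ≠ 0`
for some `i ≥ n`. This goes by induction on that projective dimension. A projective `Γ`-module `Q`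
mapping onto `M f` is lifted to a projective `A`-module `P = P f A` with `P f = Q` and a map
`P → M` (`exists_projective_extension`). There are no maps from `P` to `S`, so `Ext(P, S) = 0`, and the
kernel of `P → M` satisfies the induction hypothesis because its image under the functor is the
kernel of `Q → M f`. The cokernel is killed by `f`, so its `Ext` groups to `S` are concentrated in
degrees `≤ n`, and are nonzero in degree `n` unless it is zero. The long exact sequences give the
claim for `M`.

For `M = eA`, which is projective with `Hom(eA, S) ≠ 0`, the degree `i ≥ n` can only be `0`. Hence
`n = 0`, and `S` is self-orthogonal.

Right `A`-modules are modules over `Aᵐᵒᵖ`, and the homological part is stated for left modules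
over a ring `R` with a non-unital embedding `ι : Γ → R` whose image is the corner `f R f`,
`f = ι 1`.
-/

/-! ### `Ext` in short exact sequences -/

section ExtLemmas

open Abelian

universe v w

variable {C : Type v} [Category.{w} C] [Abelian C] [HasExt.{u} C]

namespace CategoryTheory.ShortComplex.ShortExact

variable {S : ShortComplex C} (hS : S.ShortExact) (Y : C) (n : ℕ)

include hS

lemma subsingleton_ext_X₁ (h₂ : Subsingleton (Ext S.X₂ Y n))
    (h₃ : Subsingleton (Ext S.X₃ Y (n + 1))) : Subsingleton (Ext S.X₁ Y n) := by
  refine subsingleton_of_forall_eq 0 fun x ↦ ?_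
  obtain ⟨y, rfl⟩ := Ext.contravariant_sequence_exact₁ hS Y x (add_comm 1 n)
    (Subsingleton.elim _ _)
  rw [Subsingleton.elim y 0, Ext.comp_zero]

lemma subsingleton_ext_X₂ (h₁ : Subsingleton (Ext S.X₁ Y n))
    (h₃ : Subsingleton (Ext S.X₃ Y n)) : Subsingleton (Ext S.X₂ Y n) := by
  refine subsingleton_of_forall_eq 0 fun x ↦ ?_
  obtain ⟨y, rfl⟩ := Ext.contravariant_sequence_exact₂ hS Y x (Subsingleton.elim _ _)
  rw [Subsingleton.elim y 0, Ext.comp_zero]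

lemma subsingleton_ext_X₃ (h₁ : Subsingleton (Ext S.X₁ Y n))
    (h₂ : Subsingleton (Ext S.X₂ Y (n + 1))) : Subsingleton (Ext S.X₃ Y (n + 1)) := by
  refine subsingleton_of_forall_eq 0 fun x ↦ ?_
  obtain ⟨y, rfl⟩ := Ext.contravariant_sequence_exact₃ hS Y x (Subsingleton.elim _ _)
    (add_comm 1 n)
  rw [Subsingleton.elim y 0, Ext.comp_zero]

lemma subsingleton_ext_zero_X₃ (h₂ : Subsingleton (Ext S.X₂ Y 0)) :
    Subsingleton (Ext S.X₃ Y 0) :=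
  have := hS.epi_g
  (Ext.precomp_mk₀_injective_of_epi Y S.g).subsingleton

end CategoryTheory.ShortComplex.ShortExact

lemma CategoryTheory.Retract.subsingleton_ext {X X' : C} (r : Retract X X') (Y : C) (n : ℕ)
    (h : Subsingleton (Ext X' Y n)) : Subsingleton (Ext X Y n) := by
  refine subsingleton_of_forall_eq 0 fun x ↦ ?_
  rw [← Ext.mk₀_id_comp x, ← r.retract, ← Ext.mk₀_comp_mk₀_assoc,
    Subsingleton.elim ((Ext.mk₀ r.r).comp x (zero_add n)) 0, Ext.comp_zero]

end ExtLemmas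

/-! ### `Ext` and direct sums -/

section Finsupp

open Abelian LinearMap

variable {R : Type u} [Ring R] (Y : ModuleCat.{u} R) (ι : Type u)

lemma shortExact_of_exact {X₁ X₂ X₃ : Type u} [AddCommGroup X₁] [Module R X₁] [AddCommGroup X₂]
    [Module R X₂] [AddCommGroup X₃] [Module R X₃] {a : X₁ →ₗ[R] X₂} {b : X₂ →ₗ[R] X₃}
    (ha : Function.Injective a) (hab : Function.Exact a b) (hb : Function.Surjective b) :
    (ShortComplex.mk (ModuleCat.ofHom a) (ModuleCat.ofHom b)
      (by ext x; exact hab.apply_apply_eq_zero x)).ShortExact where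
  exact := (ShortComplex.ShortExact.moduleCat_exact_iff_function_exact _).mpr hab
  mono_f := (ModuleCat.mono_iff_injective _).mpr ha
  epi_g := (ModuleCat.epi_iff_surjective _).mpr hb

lemma subsingleton_ext_zero_iff (X Y : ModuleCat.{u} R) :
    Subsingleton (Ext X Y 0) ↔ ∀ φ : X →ₗ[R] Y, φ = 0 := by
  rw [Ext.addEquiv₀.subsingleton_congr, ModuleCat.homAddEquiv.subsingleton_congr]
  exact ⟨fun h φ ↦ Subsingleton.elim _ _, fun h ↦ subsingleton_of_forall_eq 0 h⟩

/-- When `Ext¹(X₃, Y)` vanishes, linear maps to `Y` extend along `X₁ → X₂`. -/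
lemma exists_extension_of_subsingleton_ext_one {S : ShortComplex (ModuleCat.{u} R)}
    (hS : S.ShortExact) (h : Subsingleton (Ext S.X₃ Y 1)) (φ : S.X₁ ⟶ Y) :
    ∃ ψ : S.X₂ ⟶ Y, S.f ≫ ψ = φ := by
  obtain ⟨y, hy⟩ := Ext.contravariant_sequence_exact₁ hS Y (Ext.mk₀ φ) (add_zero 1)
    (Subsingleton.elim _ _)
  obtain ⟨ψ, rfl⟩ := (Ext.mk₀_bijective _ _).surjective y
  rw [Ext.mk₀_comp_mk₀] at hy
  exact ⟨ψ, (Ext.mk₀_bijective _ _).injective hy⟩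

lemma subsingleton_ext_of_projective (P : Type u) [AddCommGroup P] [Module R P]
    [Module.Projective R P] (n : ℕ) : Subsingleton (Ext (ModuleCat.of R P) Y (n + 1)) :=
  have : Projective (ModuleCat.of R P) :=
    (IsProjective.iff_projective P).mp inferInstance
  HasProjectiveDimensionLT.subsingleton (ModuleCat.of R P) 1 (n + 1) (by omega) Y

lemma exists_projective_surjective (R : Type u) [Ring R] (X : Type u) [AddCommGroup X]
    [Module R X] : ∃ (P : Type u) (_ : AddCommGroup P) (_ : Module R P)
      (_ : Module.Projective R P) (p : P →ₗ[R] X), Function.Surjective p :=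
  ⟨X →₀ R, inferInstance, inferInstance, inferInstance, _,
    Finsupp.linearCombination_id_surjective R X⟩

/-- `Ext^n(-, Y)` turns the vanishing on `X` into the vanishing on every direct sum of copies
of `X`. -/
lemma subsingleton_ext_finsupp (n : ℕ) (X : Type u) [AddCommGroup X] [Module R X]
    (h : Subsingleton (Ext (ModuleCat.of R X) Y n)) :
    Subsingleton (Ext (ModuleCat.of R (ι →₀ X)) Y n) := by
  induction n generalizing X with
  | zero =>
    rw [subsingleton_ext_zero_iff] at h ⊢
    intro φ
    refine Finsupp.lhom_ext' fun i ↦ ?_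
    rw [h (φ ∘ₗ Finsupp.lsingle i), LinearMap.zero_comp]
  | succ n ih =>
    obtain ⟨P, _, _, _, p, hp⟩ := exists_projective_surjective R X
    have hS := LinearMap.shortExact_shortComplexKer hp
    -- the kernel of a direct sum of copies of `p` is the direct sum of the kernels
    let a : (ι →₀ LinearMap.ker p) →ₗ[R] ι →₀ P :=
      Finsupp.mapRange.linearMap (LinearMap.ker p).subtype
    let b : (ι →₀ P) →ₗ[R] ι →₀ X := Finsupp.mapRange.linearMap p
    have hex : Function.Exact a b := by
      refine fun x ↦ ⟨fun hx ↦ ⟨Finsupp.onFinset x.support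
          (fun i ↦ ⟨x i, DFunLike.congr_fun hx i⟩) (fun i hi ↦ ?_), ?_⟩, ?_⟩
      · rw [Finsupp.mem_support_iff]
        exact fun h0 ↦ hi (Subtype.ext h0)
      · ext1 i; rfl
      · rintro ⟨y, rfl⟩
        ext1 i
        exact (y i).2
    have ha : Function.Injective a :=
      Finsupp.mapRange_injective _ (map_zero _) Subtype.val_injective
    have hb : Function.Surjective b := Finsupp.mapRange_surjective _ (map_zero _) hp
    have hPι : Module.Projective R (ι →₀ P) := by
      classical exact .of_equiv (finsuppLequivDFinsupp (M := P) R).symm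
    have hT := shortExact_of_exact ha hex hb
    cases n with
    | zero =>
      refine subsingleton_of_forall_eq 0 fun x ↦ ?_
      have := subsingleton_ext_of_projective Y (ι →₀ P) 0
      obtain ⟨y, rfl⟩ := Ext.contravariant_sequence_exact₃ hT Y x (Subsingleton.elim _ _)
        (add_zero 1)
      obtain ⟨φ, rfl⟩ := (Ext.mk₀_bijective _ _).surjective y
      choose ψ hψ using fun i ↦ exists_extension_of_subsingleton_ext_one Y hS h
        (ModuleCat.ofHom (φ.hom ∘ₗ Finsupp.lsingle i))
      have hφ : ModuleCat.ofHom a ≫ ModuleCat.ofHom (Finsupp.lsum ℕ fun i ↦ (ψ i).hom) = φ := by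
        ext : 1
        refine Finsupp.lhom_ext fun i x ↦ ?_
        have := congr($(hψ i).hom x)
        simpa [a] using this
      rw [← hφ, ← Ext.mk₀_comp_mk₀]
      exact hT.extClass_comp_assoc _
    | succ n =>
      refine hT.subsingleton_ext_X₃ Y _ (ih _ ?_) (subsingleton_ext_of_projective Y _ _)
      exact hS.subsingleton_ext_X₁ Y _ (subsingleton_ext_of_projective Y _ _) h
end Finsupp

/-! ### The corner part of a module -/

section CornerPart

variable {R Γ : Type u} [Ring R] [Ring Γ] (ι : Γ →ₙ+* R)

/-- For a non-unital ring homomorphism `ι : Γ → R` with `f = ι 1`, this is the subgroup `f M` of an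
`R`-module `M`, encoded as the set of fixed points of the idempotent `f`. It is a `Γ`-module
through `ι`. -/
def cornerPart (M : Type u) [AddCommGroup M] [Module R M] : AddSubgroup M where
  carrier := {m | ι 1 • m = m}
  zero_mem' := smul_zero _
  add_mem' {x y} hx hy := by
    rw [Set.mem_ofPred_eq] at hx hy ⊢
    rw [smul_add, hx, hy]
  neg_mem' {x} hx := by
    rw [Set.mem_ofPred_eq] at hx ⊢
    rw [smul_neg, hx]

variable {M N : Type u} [AddCommGroup M] [Module R M] [AddCommGroup N] [Module R N]

lemma mem_cornerPart {m : M} : m ∈ cornerPart ι M ↔ ι 1 • m = m := Iff.rfl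

lemma smul_mem_cornerPart (γ : Γ) (m : M) : ι γ • m ∈ cornerPart ι M := by
  rw [mem_cornerPart, ← mul_smul, ← map_mul, one_mul]

instance : SMul Γ (cornerPart ι M) where
  smul γ m := ⟨ι γ • (m : M), smul_mem_cornerPart ι γ (m : M)⟩

@[simp] lemma coe_cornerPart_smul (γ : Γ) (m : cornerPart ι M) :
    ((γ • m : cornerPart ι M) : M) = ι γ • (m : M) := rfl

instance : Module Γ (cornerPart ι M) where
  one_smul m := Subtype.ext m.2
  mul_smul γ δ m := Subtype.ext <| by simp [mul_smul]
  smul_zero γ := Subtype.ext <| smul_zero _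
  smul_add γ m m' := Subtype.ext <| smul_add _ _ _
  add_smul γ δ m := Subtype.ext <| by simp [add_smul]
  zero_smul m := Subtype.ext <| by simp

/-- Generation by the corner part turns the vanishing of `f N` into the vanishing of maps
to `N`. -/
lemma linearMap_eq_zero_of_span_cornerPart (hM : Submodule.span R (cornerPart ι M : Set M) = ⊤)
    (hN : ∀ x : N, ι 1 • x = 0) (g : M →ₗ[R] N) : g = 0 := by
  refine LinearMap.ext_on hM fun m hm ↦ ?_
  rw [LinearMap.zero_apply, ← (mem_cornerPart ι).mp hm, map_smul, hN]

/-- An additive map `ψ` that is semilinear along `ι` commutes with linear combinations. -/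
lemma linearCombination_mapRange {Q : Type u} [AddCommGroup Q] [Module Γ Q] (ψ : Q →+ N)
    (hψ : ∀ (γ : Γ) q, ψ (γ • q) = ι γ • ψ q) (x : Q →₀ Γ) :
    Finsupp.linearCombination R ψ (Finsupp.mapRange ι (map_zero ι) x) =
      ψ (Finsupp.linearCombination Γ id x) := by
  induction x using Finsupp.induction_linear with
  | zero => simp
  | add x y hx hy => rw [Finsupp.mapRange_add (map_add ι), map_add, hx, hy, map_add, map_add]
  | single q γ => simp [hψ]

/-- A projective `Γ`-module `Q` is the corner part of a projective `R`-module `P` that is generated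
by its corner part, and maps from `Q` into a corner part extend to `P`. This `P` plays the role of
the tensor product `R f ⊗ Q`; it is the image of the idempotent endomorphism of a free `R`-module
that splits off `Q` from a free `Γ`-module. -/
lemma exists_projective_extension (hinj : Function.Injective ι)
    (hcorner : ∀ r, ∃ γ, ι γ = ι 1 * r * ι 1)
    {Q : Type u} [AddCommGroup Q] [Module Γ Q] [Module.Projective Γ Q]
    (φ : Q →ₗ[Γ] cornerPart ι M) :
    ∃ (P : Type u) (_ : AddCommGroup P) (_ : Module R P) (_ : Module.Projective R P)
      (g : P →ₗ[R] M) (θ : Q ≃ₗ[Γ] cornerPart ι P),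
      (∀ q, g (θ q) = φ q) ∧ Submodule.span R (cornerPart ι P : Set P) = ⊤ := by
  obtain ⟨s, hs⟩ := Module.projective_def'.mp ‹Module.Projective Γ Q›
  replace hs (q : Q) : Finsupp.linearCombination Γ id (s q) = q := DFunLike.congr_fun hs q
  let σ : Q →+ (Q →₀ R) := (Finsupp.mapRange.addMonoidHom (ι : Γ →+ R)).comp s.toAddMonoidHom
  have hσ (q : Q) : σ q = Finsupp.mapRange ι (map_zero ι) (s q) := rfl
  have hσs (γ : Γ) (q : Q) : σ (γ • q) = ι γ • σ q := by
    ext j; simp [hσ]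
  let ε : (Q →₀ R) →ₗ[R] (Q →₀ R) := Finsupp.linearCombination R σ
  have hε (q : Q) : ε (σ q) = σ q := by
    rw [hσ, linearCombination_mapRange ι σ hσs, hs, hσ]
  have hεε (x : Q →₀ R) : ε (ε x) = ε x := by
    induction x using Finsupp.induction_linear with
    | zero => simp
    | add x y hx hy => simp only [map_add, hx, hy]
    | single q r => simp only [ε, Finsupp.linearCombination_single, map_smul]; rw [hε]
  let P := LinearMap.range ε
  have hP (p : P) : ε p = p := by
    obtain ⟨_, x, rfl⟩ := p
    exact hεε x
  let g : P →ₗ[R] M := Finsupp.linearCombination R (fun q ↦ (φ q : M)) ∘ₗ P.subtype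
  have hσ1 (q : Q) : ι 1 • σ q = σ q := by rw [← hσs, one_smul]
  let θ : Q →ₗ[Γ] cornerPart ι P :=
    { toFun q := ⟨⟨σ q, σ q, hε q⟩, Subtype.ext (hσ1 q)⟩
      map_add' x y := Subtype.ext <| Subtype.ext <| map_add σ x y
      map_smul' γ x := Subtype.ext <| Subtype.ext <| hσs γ x }
  -- the coordinates of the elements of `P` are fixed by right multiplication with `f`
  have hPf (p : P) (j : Q) : (p : Q →₀ R) j * ι 1 = (p : Q →₀ R) j := by
    obtain ⟨_, x, rfl⟩ := p
    induction x using Finsupp.induction_linear with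
    | zero => simp
    | add x y hx hy => simp only [map_add, Finsupp.add_apply, add_mul] at hx hy ⊢; rw [hx, hy]
    | single q r => simp [ε, hσ, mul_assoc, ← map_mul]
  have hθ : Function.Bijective θ := by
    constructor
    · intro x y hxy
      have h : σ x = σ y := congr_arg (fun z : cornerPart ι P ↦ ((z : P) : Q →₀ R)) hxy
      rw [← hs x, ← hs y]
      exact congr_arg _ (Finsupp.mapRange_injective ι (map_zero ι) hinj h)
    · rintro ⟨p, hp⟩
      choose γ hγ using fun j ↦ hcorner ((p : Q →₀ R) j)
      have hp' (j : Q) : ι 1 * (p : Q →₀ R) j = (p : Q →₀ R) j :=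
        DFunLike.congr_fun (congr_arg Subtype.val hp) j
      replace hγ (j : Q) : ι (γ j) = (p : Q →₀ R) j := by rw [hγ, hp', hPf]
      let x : Q →₀ Γ := Finsupp.onFinset (p : Q →₀ R).support γ fun j hj ↦ by
        rw [Finsupp.mem_support_iff, ← hγ]
        exact fun h ↦ hj (hinj (h.trans (map_zero ι).symm))
      have hx : Finsupp.mapRange ι (map_zero ι) x = p := by
        ext j; exact hγ j
      refine ⟨Finsupp.linearCombination Γ id x, Subtype.ext <| Subtype.ext ?_⟩
      change σ _ = (p : Q →₀ R)
      rw [← linearCombination_mapRange ι σ hσs, hx]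
      exact hP p
  refine ⟨P, inferInstance, inferInstance, .of_split P.subtype ε.rangeRestrict ?_, g,
    LinearEquiv.ofBijective θ hθ, fun q ↦ ?_, ?_⟩
  · ext p : 2
    exact hP p
  · change Finsupp.linearCombination R (fun q ↦ (φ q : M)) (σ q) = φ q
    rw [hσ]
    refine (linearCombination_mapRange ι ((cornerPart ι M).subtype.comp φ.toAddMonoidHom)
      (fun γ q ↦ ?_) (s q)).trans ?_
    · simp
    · simp [hs]
  · rw [eq_top_iff]
    rintro ⟨_, x, rfl⟩ -
    change ε.rangeRestrict x ∈ _
    induction x using Finsupp.induction_linear with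
    | zero => rw [map_zero]; exact Submodule.zero_mem _
    | add x y hx hy => rw [map_add]; exact Submodule.add_mem _ hx hy
    | single q r =>
      have h := Submodule.smul_mem _ r (Submodule.subset_span (R := R) (θ q).2)
      convert h using 1
      ext1
      simp [ε, θ]

/-- If `g : P → M` restricts to `φ : Q → fM` on the corner part `fP ≅ Q`, then the corner part of
the kernel of `g` is the kernel of `φ`. -/
lemma nonempty_ker_equiv_cornerPart_ker {P Q : Type u} [AddCommGroup P] [Module R P]
    [AddCommGroup Q] [Module Γ Q] (φ : Q →ₗ[Γ] cornerPart ι M) (g : P →ₗ[R] M)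
    (θ : Q ≃ₗ[Γ] cornerPart ι P) (h : ∀ q, g (θ q) = φ q) :
    Nonempty (LinearMap.ker φ ≃ₗ[Γ] cornerPart ι (LinearMap.ker g)) := by
  let κ : LinearMap.ker φ →ₗ[Γ] cornerPart ι (LinearMap.ker g) :=
    { toFun q := ⟨⟨θ (q : Q), by
          rw [LinearMap.mem_ker, h, LinearMap.mem_ker.mp q.2, ZeroMemClass.coe_zero]⟩,
        Subtype.ext (θ (q : Q)).2⟩
      map_add' x y := by ext; simp
      map_smul' γ x := by ext; simp }
  refine ⟨LinearEquiv.ofBijective κ ⟨fun x y hxy ↦ ?_, fun y ↦ ?_⟩⟩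
  · have h' : ((θ (x : Q) : cornerPart ι P) : P) = θ (y : Q) :=
      congr_arg (fun z : cornerPart ι (LinearMap.ker g) ↦ ((z : LinearMap.ker g) : P)) hxy
    exact Subtype.ext (θ.injective (Subtype.ext h'))
  · let z : cornerPart ι P := ⟨y, congr_arg Subtype.val y.2⟩
    refine ⟨⟨θ.symm z, ?_⟩, ?_⟩
    · rw [LinearMap.mem_ker]
      ext
      rw [← h, LinearEquiv.apply_symm_apply]
      exact LinearMap.mem_ker.mp (y : LinearMap.ker g).2
    · ext
      simp [z, κ]

end CornerPart

/-! ### `Ext` and the projective dimension of the corner part -/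

section Dichotomy

open Abelian

variable {R Γ : Type u} [Ring R] [Ring Γ] (ι : Γ →ₙ+* R)

/-- The index of `HasProjectiveDimensionLT` drops by one from a module to a suitable syzygy. For
`d = 0` the module is projective and covers itself, so that the syzygy is zero. -/
lemma exists_projective_surjective_ker (X : Type u) [AddCommGroup X] [Module Γ X] (d : ℕ)
    (hX : HasProjectiveDimensionLT (ModuleCat.of Γ X) (d + 1)) :
    ∃ (Q : Type u) (_ : AddCommGroup Q) (_ : Module Γ Q) (_ : Module.Projective Γ Q)
      (φ : Q →ₗ[Γ] X), Function.Surjective φ ∧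
        HasProjectiveDimensionLT (ModuleCat.of Γ (LinearMap.ker φ)) d := by
  cases d with
  | zero =>
    have : Module.Projective Γ X :=
      (IsProjective.iff_projective X).mpr (projective_iff_hasProjectiveDimensionLT_one.mpr hX)
    refine ⟨X, inferInstance, inferInstance, this, LinearMap.id, Function.surjective_id, ?_⟩
    have : Subsingleton (LinearMap.ker (LinearMap.id : X →ₗ[Γ] X)) := by
      rw [LinearMap.ker_id]; infer_instance
    exact (ModuleCat.isZero_of_subsingleton _).hasProjectiveDimensionLT_zero
  | succ d =>
    obtain ⟨Q, _, _, hQ, p, hp⟩ := exists_projective_surjective Γ X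
    have : Projective (ModuleCat.of Γ Q) := (IsProjective.iff_projective Q).mp hQ
    exact ⟨Q, _, _, hQ, p, hp,
      (LinearMap.shortExact_shortComplexKer hp).hasProjectiveDimensionLT_X₁ (d + 1)
        (inferInstanceAs (HasProjectiveDimensionLT (ModuleCat.of Γ Q) (d + 1))) hX⟩

/-- Suppose that `f` kills `S`, and that for the nonzero modules `T` killed by `f` the top degree of
`Ext(T, S)` is `n`. Then a module `M` whose corner part has finite projective dimension
either has `Ext(M, S) = 0`, or has a nonzero `Ext` to `S` in some degree `≥ n`.

The step replaces `M` by the kernel `M'` of a map `P → M` from a projective module generated by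
its corner part, where the corner part of `P` surjects onto that of `M`. Here `Ext(P, S) = 0`, so
that passing from `M'` to the image `I` of `P` shifts the degrees of `Ext` up by one, and
`M / I` is killed by `f`. -/
theorem ext_eq_zero_or_exists_ge (hinj : Function.Injective ι)
    (hcorner : ∀ r, ∃ γ, ι γ = ι 1 * r * ι 1) (S : ModuleCat.{u} R) (hS : ∀ s : S, ι 1 • s = 0)
    (n : ℕ)
    (htop : ∀ T : ModuleCat.{u} R, (∀ t : T, ι 1 • t = 0) →
      (∀ i, n < i → Subsingleton (Ext T S i)) ∧ (Subsingleton (Ext T S n) → Subsingleton T))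
    (d : ℕ) (M : ModuleCat.{u} R)
    (hM : HasProjectiveDimensionLT (ModuleCat.of Γ (cornerPart ι M)) d) :
    (∀ i, Subsingleton (Ext M S i)) ∨ ∃ i, n ≤ i ∧ ¬ Subsingleton (Ext M S i) := by
  induction d generalizing M with
  | zero =>
    have hsub : Subsingleton (cornerPart ι M) :=
      ModuleCat.subsingleton_of_isZero
        (isZero_of_hasProjectiveDimensionLT_zero (ModuleCat.of Γ (cornerPart ι M)))
    have hM0 (m : M) : ι 1 • m = 0 := congr_arg Subtype.val
      (Subsingleton.elim (⟨ι 1 • m, smul_mem_cornerPart ι 1 m⟩ : cornerPart ι M) 0)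
    by_cases h : Subsingleton (Ext M S n)
    · have := (htop M hM0).2 h
      exact .inl fun i ↦ HasProjectiveDimensionLT.subsingleton (hX :=
        (ModuleCat.isZero_of_subsingleton M).hasProjectiveDimensionLT_zero) M 0 i i.zero_le S
    · exact .inr ⟨n, le_rfl, h⟩
  | succ d ih =>
    obtain ⟨Q, _, _, hQ, φ, hφ, hker⟩ := exists_projective_surjective_ker _ d hM
    obtain ⟨P, _, _, hP, g, θ, hθ, hspan⟩ := exists_projective_extension ι hinj hcorner φ
    have hPS (i : ℕ) : Subsingleton (Ext (ModuleCat.of R P) S i) := by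
      cases i with
      | zero =>
        exact (subsingleton_ext_zero_iff _ _).mpr
          (linearMap_eq_zero_of_span_cornerPart ι hspan hS)
      | succ i => exact subsingleton_ext_of_projective S P i
    obtain ⟨e⟩ := nonempty_ker_equiv_cornerPart_ker ι φ g θ hθ
    have hT (t : M ⧸ LinearMap.range g) : ι 1 • t = 0 := by
      obtain ⟨m, rfl⟩ := Submodule.Quotient.mk_surjective _ t
      rw [← Submodule.Quotient.mk_smul, Submodule.Quotient.mk_eq_zero]
      obtain ⟨q, hq⟩ := hφ ⟨ι 1 • m, smul_mem_cornerPart ι 1 m⟩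
      exact ⟨θ q, by rw [hθ, hq]⟩
    obtain ⟨hT₁, hT₂⟩ := htop (ModuleCat.of R (M ⧸ LinearMap.range g)) hT
    have hses₁ := shortExact_of_exact (LinearMap.ker g).injective_subtype
      (a := (LinearMap.ker g).subtype) (b := g.rangeRestrict)
      (fun x ↦ by simp [Subtype.ext_iff]) g.surjective_rangeRestrict
    have hses₂ := shortExact_of_exact (LinearMap.range g).injective_subtype
      (LinearMap.exact_subtype_mkQ _) (Submodule.mkQ_surjective _)
    have hI₀ := hses₁.subsingleton_ext_zero_X₃ S (hPS 0)
    have hM' := hasProjectiveDimensionLT_of_iso e.toModuleIso d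
    rcases ih (ModuleCat.of R (LinearMap.ker g)) hM' with h | ⟨i, hi, h⟩
    · have hI (i : ℕ) : Subsingleton (Ext (ModuleCat.of R (LinearMap.range g)) S i) := by
        cases i with
        | zero => exact hI₀
        | succ i => exact hses₁.subsingleton_ext_X₃ S i (h i) (hPS _)
      by_cases hMn : Subsingleton (Ext M S n)
      · have hTn : Subsingleton (Ext (ModuleCat.of R (M ⧸ LinearMap.range g)) S n) := by
          cases n with
          | zero => exact hses₂.subsingleton_ext_zero_X₃ S hMn
          | succ n => exact hses₂.subsingleton_ext_X₃ S n (hI n) hMn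
        have := hT₂ hTn
        exact .inl fun i ↦ hses₂.subsingleton_ext_X₂ S i (hI i)
          (HasProjectiveDimensionLT.subsingleton (hX :=
            (ModuleCat.isZero_of_subsingleton _).hasProjectiveDimensionLT_zero) _ 0 i i.zero_le S)
      · exact .inr ⟨n, le_rfl, hMn⟩
    · refine .inr ⟨i + 1, by omega, fun hMi ↦ h ?_⟩
      exact hses₁.subsingleton_ext_X₁ S i (hPS i)
        (hses₂.subsingleton_ext_X₁ S (i + 1) hMi (hT₁ _ (by omega)))

end Dichotomy

/-! ### Idempotents and the Jacobson radical -/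

section Radical

variable {A : Type u} [Ring A]

lemma exists_mul_eq_one_of_mem_jacobson {x : A} (hx : x ∈ Ring.jacobson A) :
    ∃ z, z * (1 + x) = 1 ∧ (1 + x) * z = 1 := by
  have key {y : A} (hy : y ∈ Ring.jacobson A) : ∃ z, z * (1 + y) = 1 := by
    rw [← Ideal.jacobson_bot] at hy
    obtain ⟨z, hz⟩ := Ideal.exists_mul_add_sub_mem_of_mem_jacobson y hy
    exact ⟨z, by rwa [Ideal.mem_bot, sub_eq_zero, add_comm] at hz⟩
  obtain ⟨z, hz⟩ := key hx
  -- the left inverse `z` is itself of the form `1 + y` with `y` in the radical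
  obtain ⟨w, hw⟩ := key (neg_mem (Ideal.mul_mem_left _ z hx))
  have hz' : 1 + -(z * x) = z := by rw [← hz]; noncomm_ring
  rw [hz'] at hw
  refine ⟨z, hz, ?_⟩
  rwa [← left_inv_eq_right_inv hw hz]

/-- One half of the left-right symmetry of the Jacobson radical. -/
lemma op_mem_jacobson {x : A} (hx : x ∈ Ring.jacobson A) : op x ∈ Ring.jacobson Aᵐᵒᵖ := by
  rw [← Ideal.jacobson_bot, Ideal.mem_jacobson_iff]
  intro y
  obtain ⟨z, -, hz⟩ := exists_mul_eq_one_of_mem_jacobson (Ideal.mul_mem_right y.unop _ hx)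
  refine ⟨op z, ?_⟩
  rw [Ideal.mem_bot, sub_eq_zero]
  apply unop_injective
  simp only [MulOpposite.unop_add, MulOpposite.unop_mul, MulOpposite.unop_op, MulOpposite.unop_one]
  rw [← hz]
  noncomm_ring

lemma IsIdempotentElem.eq_zero_of_mem_jacobson {e : A} (he : IsIdempotentElem e)
    (h : e ∈ Ring.jacobson A) : e = 0 := by
  obtain ⟨z, hz, -⟩ := exists_mul_eq_one_of_mem_jacobson (neg_mem h)
  calc e = z * (1 + -e) * e := by rw [hz, one_mul]
    _ = z * (e - e * e) := by noncomm_ring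
    _ = 0 := by rw [he.eq, sub_self, mul_zero]

/-- Idempotents below `e` lift modulo the radical to idempotents below `e`, as soon as they lift
to idempotents of the whole ring. -/
lemma exists_isIdempotentElem_lift_below {e g₀ : A} (he : IsIdempotentElem e)
    (hg₀ : IsIdempotentElem g₀)
    (h₁ : e * g₀ - g₀ ∈ Ring.jacobson A) (h₂ : g₀ * e - g₀ ∈ Ring.jacobson A) :
    ∃ g, IsIdempotentElem g ∧ e * g = g ∧ g * e = g ∧ g - g₀ ∈ Ring.jacobson A := by
  -- conjugate `g₀` by the unit `v = 1 - g₀ (1 - e)`, which is congruent to `1`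
  obtain ⟨w, hw, hw'⟩ := exists_mul_eq_one_of_mem_jacobson h₂
  set v := 1 + (g₀ * e - g₀) with hv
  have hgv : g₀ * v = g₀ * e := by
    rw [hv]
    calc g₀ * (1 + (g₀ * e - g₀)) = g₀ + (g₀ * g₀) * e - g₀ * g₀ := by noncomm_ring
      _ = g₀ * e := by rw [hg₀.eq]; noncomm_ring
  have hh : w * g₀ * e * (w * g₀ * e) = w * g₀ * e := by
    calc w * g₀ * e * (w * g₀ * e) = w * (g₀ * e) * (w * (g₀ * e)) := by noncomm_ring
      _ = w * g₀ * (v * w) * (g₀ * v) := by rw [← hgv]; noncomm_ring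
      _ = w * (g₀ * g₀ * v) := by rw [hw']; noncomm_ring
      _ = w * g₀ * e := by rw [hg₀.eq, hgv]; noncomm_ring
  refine ⟨e * (w * g₀ * e), ?_, ?_, ?_, ?_⟩
  · calc e * (w * g₀ * e) * (e * (w * g₀ * e)) = e * (w * g₀ * (e * e) * (w * g₀ * e)) := by
          noncomm_ring
      _ = e * (w * g₀ * e) := by rw [he.eq, hh]
  · rw [← mul_assoc, he.eq]
  · rw [mul_assoc, mul_assoc, he.eq]
  · have hw1 : w - 1 ∈ Ring.jacobson A := by
      have : w - 1 = -(w * (g₀ * e - g₀)) := by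
        rw [← hw, hv]; noncomm_ring
      rw [this]
      exact neg_mem (Ideal.mul_mem_left _ _ h₂)
    have : e * (w * g₀ * e) - g₀ =
        e * ((w - 1) * (g₀ * e)) + e * (g₀ * e - g₀) + (e * g₀ - g₀) := by noncomm_ring
    rw [this]
    exact add_mem (add_mem (Ideal.mul_mem_left _ _ (Ideal.mul_mem_right _ _ hw1))
      (Ideal.mul_mem_left _ _ h₂)) h₁

/-- In a basic semiperfect ring, a primitive idempotent is modulo the radical the unit element of
one of the division rings in the product decomposition. -/
lemma IsPrimitiveIdempotent.exists_mk_eq_single {e : A} (he : IsPrimitiveIdempotent e)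
    (hA : IsSemiperfectRing A) {n : ℕ} {D : Fin n → Type u} [∀ i, DivisionRing (D i)]
    (φ : (A ⧸ Ring.jacobson A) ≃+* (∀ i, D i)) :
    ∃ i, φ (Ideal.Quotient.mk _ e) = Pi.single i 1 := by
  have hid : IsIdempotentElem (φ (Ideal.Quotient.mk _ e)) := by
    rw [IsIdempotentElem, ← map_mul, ← map_mul, he.idem.eq]
  have h0 : φ (Ideal.Quotient.mk _ e) ≠ 0 := by
    rw [Ne, map_eq_zero_iff _ φ.injective, Ideal.Quotient.eq_zero_iff_mem]
    exact fun h ↦ he.ne_zero (he.idem.eq_zero_of_mem_jacobson h)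
  obtain ⟨i, hi⟩ := Function.ne_iff.mp h0
  have hi1 : φ (Ideal.Quotient.mk _ e) i = 1 :=
    (IsIdempotentElem.iff_eq_zero_or_one.mp (congr_fun hid.eq i)).resolve_left hi
  refine ⟨i, ?_⟩
  let x : ∀ i, D i := Pi.single i 1
  have hx : IsIdempotentElem x := by
    simp [IsIdempotentElem, x, ← Pi.single_mul]
  have hxe : φ (Ideal.Quotient.mk _ e) * x = x := by
    ext j
    by_cases h : j = i
    · subst h; simp [x, hi1]
    · simp [x, h]
  have hex : x * φ (Ideal.Quotient.mk _ e) = x := by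
    ext j
    by_cases h : j = i
    · subst h; simp [x, hi1]
    · simp [x, h]
  obtain ⟨g₀, hg₀, hg₀x⟩ := hA.lift_idempotent (φ.symm x) (by
    rw [IsIdempotentElem, ← map_mul, hx.eq])
  have hφg₀ : φ (Ideal.Quotient.mk _ g₀) = x := by rw [hg₀x, RingEquiv.apply_symm_apply]
  obtain ⟨g, hg, heg, hge, hgg₀⟩ := exists_isIdempotentElem_lift_below he.idem hg₀
    (by rw [← Ideal.Quotient.eq, map_mul]; apply φ.injective; rw [map_mul, hφg₀, hxe])
    (by rw [← Ideal.Quotient.eq, map_mul]; apply φ.injective; rw [map_mul, hφg₀, hex])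
  have hφg : φ (Ideal.Quotient.mk _ g) = x := by rw [Ideal.Quotient.eq.mpr hgg₀, hφg₀]
  rcases he.eq_zero_or_eq_zero g (e - g) hg
    (by simp [IsIdempotentElem, mul_sub, sub_mul, heg, hge, hg.eq, he.idem.eq])
    (by simp [mul_sub, hge, hg.eq]) (by simp [sub_mul, heg, hg.eq]) (by abel) with h | h
  · rw [h, map_zero, map_zero] at hφg
    exact absurd (congr_fun hφg i) (by simp [x])
  · rw [sub_eq_zero.mp h]
    exact hφg

/-- The simple top of `eA` does not occur in the top of `(1 - e)A`, because `e` is central modulo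
the radical of a basic ring. -/
lemma IsPrimitiveIdempotent.mul_mul_one_sub_mem_jacobson {e : A} (he : IsPrimitiveIdempotent e)
    (hA : IsSemiperfectRing A) (hb : IsBasicRing A) (a : A) :
    e * a * (1 - e) ∈ Ring.jacobson A := by
  obtain ⟨n, D, _, ⟨φ⟩⟩ := hb
  obtain ⟨i, hi⟩ := he.exists_mk_eq_single hA φ
  rw [← Ideal.Quotient.eq_zero_iff_mem, ← map_eq_zero_iff _ φ.injective]
  simp only [map_mul, map_sub, map_one, hi]
  ext j
  by_cases h : j = i
  · subst h; simp
  · simp [h]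

lemma IsPrimitiveIdempotent.exists_mul_sub_mem_jacobson {e : A} (he : IsPrimitiveIdempotent e)
    (hA : IsSemiperfectRing A) (hb : IsBasicRing A) {a : A} (ha : e * a ∉ Ring.jacobson A) :
    ∃ b, e * a * b - e ∈ Ring.jacobson A := by
  obtain ⟨n, D, _, ⟨φ⟩⟩ := hb
  obtain ⟨i, hi⟩ := he.exists_mk_eq_single hA φ
  have ha' : φ (Ideal.Quotient.mk _ a) i ≠ 0 := by
    intro h
    apply ha
    rw [← Ideal.Quotient.eq_zero_iff_mem, ← map_eq_zero_iff _ φ.injective]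
    simp only [map_mul, hi]
    ext j
    by_cases hj : j = i
    · subst hj; simp [h]
    · simp [hj]
  obtain ⟨b, hb⟩ := Ideal.Quotient.mk_surjective
    (φ.symm (Pi.single i (φ (Ideal.Quotient.mk _ a) i)⁻¹))
  refine ⟨b, ?_⟩
  rw [← Ideal.Quotient.eq]
  apply φ.injective
  simp only [map_mul, hi, hb, RingEquiv.apply_symm_apply]
  ext j
  by_cases hj : j = i
  · subst hj; simp [ha']
  · simp [hj]

end Radical

/-! ### The simple top of a primitive idempotent -/

section SimpleTop

variable {A : Type u} [Ring A]

/-- The generator of the right ideal `eA`. -/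
def idempotentGen (e : A) : idempotentIdeal e := ⟨e, 1, (mul_one e).symm⟩

lemma exists_op_smul_idempotentGen {e : A} (x : idempotentIdeal e) :
    ∃ a : A, x = op a • idempotentGen e := by
  obtain ⟨_, a, rfl⟩ := x
  exact ⟨a, rfl⟩

/-- The generator of the top of `eA`. -/
def simpleTopGen (e : A) : simpleTop e := Submodule.Quotient.mk (idempotentGen e)

lemma exists_op_smul_simpleTopGen {e : A} (s : simpleTop e) :
    ∃ a : A, s = op a • simpleTopGen e := by
  obtain ⟨x, rfl⟩ := Submodule.Quotient.mk_surjective _ s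
  obtain ⟨a, rfl⟩ := exists_op_smul_idempotentGen x
  exact ⟨a, rfl⟩

lemma op_smul_simpleTopGen_eq_zero {e : A} (he : IsIdempotentElem e) {a : A} :
    op a • simpleTopGen e = 0 ↔ e * a ∈ Ring.jacobson A := by
  refine (Submodule.Quotient.mk_eq_zero (M := idempotentIdeal e) (x := op a • idempotentGen e)
    ((idempotentRad e).submoduleOf (idempotentIdeal e))).trans ?_
  constructor
  · rintro ⟨j, hj, h⟩
    exact (show e * a = e * j from h) ▸ Ideal.mul_mem_left _ _ hj
  · intro h
    exact ⟨e * a, h, by rw [← mul_assoc, he.eq]; rfl⟩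

lemma op_smul_simpleTop_of_mem_jacobson {e : A} (he : IsIdempotentElem e) {j : A}
    (hj : j ∈ Ring.jacobson A) (s : simpleTop e) : op j • s = 0 := by
  obtain ⟨a, rfl⟩ := exists_op_smul_simpleTopGen s
  rw [← mul_smul, ← op_mul, op_smul_simpleTopGen_eq_zero he]
  exact Ideal.mul_mem_left _ _ (Ideal.mul_mem_left _ _ hj)

variable {e : A} (he : IsPrimitiveIdempotent e) (hA : IsSemiperfectRing A) (hb : IsBasicRing A)

include he in
lemma simpleTopGen_ne_zero : simpleTopGen e ≠ 0 := by
  intro h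
  have h1 := (op_smul_simpleTopGen_eq_zero (a := 1) he.idem).mp (by rw [h, smul_zero])
  rw [mul_one] at h1
  exact he.ne_zero (he.idem.eq_zero_of_mem_jacobson h1)

include he hA hb

lemma op_one_sub_smul_simpleTop (s : simpleTop e) : op (1 - e) • s = 0 := by
  obtain ⟨a, rfl⟩ := exists_op_smul_simpleTopGen s
  rw [← mul_smul, ← op_mul, op_smul_simpleTopGen_eq_zero he.idem, ← mul_assoc]
  exact he.mul_mul_one_sub_mem_jacobson hA hb a

lemma isSimpleModule_simpleTop : IsSimpleModule Aᵐᵒᵖ (simpleTop e) := by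
  rw [isSimpleModule_iff_toSpanSingleton_surjective]
  refine ⟨⟨_, _, simpleTopGen_ne_zero he⟩, fun x hx y ↦ ?_⟩
  obtain ⟨a, rfl⟩ := exists_op_smul_simpleTopGen x
  obtain ⟨c, rfl⟩ := exists_op_smul_simpleTopGen y
  obtain ⟨b, hb⟩ := he.exists_mul_sub_mem_jacobson hA hb
    (mt (op_smul_simpleTopGen_eq_zero he.idem).mpr hx)
  refine ⟨op (b * c), ?_⟩
  rw [LinearMap.toSpanSingleton_apply, ← sub_eq_zero, ← mul_smul, ← sub_smul, ← op_mul,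
    ← MulOpposite.op_sub, op_smul_simpleTopGen_eq_zero he.idem]
  convert Ideal.mul_mem_right c _ hb using 1
  noncomm_ring

/-- A module killed by `1 - e` and by the radical is a direct sum of copies of the simple top
of `eA`: each of its nonzero elements generates such a copy. -/
lemma nonempty_linearEquiv_finsupp_simpleTop (T : Type u) [AddCommGroup T] [Module Aᵐᵒᵖ T]
    (h₁ : ∀ t : T, op (1 - e) • t = 0)
    (h₂ : ∀ j ∈ Ring.jacobson A, ∀ t : T, op j • t = 0) :
    ∃ I : Type u, Nonempty (T ≃ₗ[Aᵐᵒᵖ] I →₀ simpleTop e) := by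
  have hsimple := isSimpleModule_simpleTop he hA hb
  have hspan (t : T) (ht : t ≠ 0) :
      Nonempty (Submodule.span Aᵐᵒᵖ {t} ≃ₗ[Aᵐᵒᵖ] simpleTop e) := by
    have hker : LinearMap.ker (LinearMap.toSpanSingleton Aᵐᵒᵖ _ (simpleTopGen e)) ≤
        LinearMap.ker (LinearMap.toSpanSingleton Aᵐᵒᵖ T t) := by
      intro r hr
      rw [LinearMap.mem_ker, LinearMap.toSpanSingleton_apply] at hr ⊢
      obtain ⟨a, rfl⟩ := op_surjective r
      have het : op e • t = t := by
        have := h₁ t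
        rw [MulOpposite.op_sub, sub_smul, MulOpposite.op_one, one_smul, sub_eq_zero] at this
        exact this.symm
      rw [← het, ← mul_smul, ← op_mul]
      exact h₂ _ ((op_smul_simpleTopGen_eq_zero he.idem).mp hr) t
    have hsurj : Function.Surjective (LinearMap.toSpanSingleton Aᵐᵒᵖ _ (simpleTopGen e)) :=
      (isSimpleModule_iff_toSpanSingleton_surjective.mp hsimple).2 _ (simpleTopGen_ne_zero he)
    let f : simpleTop e →ₗ[Aᵐᵒᵖ] T := Submodule.liftQ _ _ hker ∘ₗ
      (LinearMap.quotKerEquivOfSurjective _ hsurj).symm.toLinearMap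
    have hf (r : Aᵐᵒᵖ) : f (r • simpleTopGen e) = r • t := by
      have : (LinearMap.quotKerEquivOfSurjective _ hsurj).symm (r • simpleTopGen e) =
          Submodule.Quotient.mk r := by
        rw [LinearEquiv.symm_apply_eq]; rfl
      rw [LinearMap.comp_apply, LinearEquiv.coe_coe, this]
      rfl
    have hf0 : f ≠ 0 := by
      intro h0
      have := hf 1
      rw [h0, LinearMap.zero_apply, one_smul] at this
      exact ht this.symm
    have hrange : LinearMap.range f = Submodule.span Aᵐᵒᵖ {t} := by
      ext x
      rw [Submodule.mem_span_singleton]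
      constructor
      · rintro ⟨s, rfl⟩
        obtain ⟨a, rfl⟩ := exists_op_smul_simpleTopGen s
        exact ⟨op a, (hf _).symm⟩
      · rintro ⟨r, rfl⟩
        exact ⟨_, hf r⟩
    rw [← hrange]
    exact ⟨(LinearEquiv.ofInjective f (f.injective_of_ne_zero hf0)).symm⟩
  have hss : IsSemisimpleModule Aᵐᵒᵖ T := by
    refine .of_sSup_simples_eq_top (eq_top_iff.mpr fun t _ ↦ ?_)
    by_cases ht : t = 0
    · rw [ht]; exact zero_mem _
    · exact (le_sSup (a := Submodule.span Aᵐᵒᵖ {t})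
        (.congr (hspan t ht).some)) (Submodule.mem_span_singleton_self t)
  have hiso : IsIsotypicOfType Aᵐᵒᵖ T (simpleTop e) := by
    intro m hm
    have := hm.nontrivial
    obtain ⟨t, ht, ht0⟩ := m.ne_bot_iff.mp ((Submodule.nontrivial_iff_ne_bot).mp this)
    have : Submodule.span Aᵐᵒᵖ {t} = m := by
      refine ((isSimpleModule_iff_isAtom.mp hm).le_iff.mp
        ((Submodule.span_singleton_le_iff_mem _ _).mpr ht)).resolve_left ?_
      rwa [Submodule.span_singleton_eq_bot]
    exact this ▸ hspan t ht0
  exact hiso.linearEquiv_finsupp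

end SimpleTop

/-! ### Modules killed by the complementary idempotent -/

section Complementary
open Abelian

variable {A : Type u} [Ring A]

lemma projective_idempotentIdeal {e : A} (he : IsIdempotentElem e) :
    Module.Projective Aᵐᵒᵖ (idempotentIdeal e) := by
  let i : idempotentIdeal e →ₗ[Aᵐᵒᵖ] Aᵐᵒᵖ :=
    { toFun x := op (x : A)
      map_add' _ _ := rfl
      map_smul' _ _ := rfl }
  refine .of_split i (LinearMap.toSpanSingleton Aᵐᵒᵖ _ (idempotentGen e)) ?_
  ext ⟨_, a, rfl⟩
  change e * (e * a) = e * a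
  rw [← mul_assoc, he.eq]

/-- The linear map `eA → T`, `x ↦ t x`, given by an element `t` of a right module `T`. -/
def idempotentIdealToModule (e : A) {T : Type u} [AddCommGroup T] [Module Aᵐᵒᵖ T] (t : T) :
    idempotentIdeal e →ₗ[Aᵐᵒᵖ] T where
  toFun x := op (x : A) • t
  map_add' x y := by rw [Submodule.coe_add, MulOpposite.op_add, add_smul]
  map_smul' r x := (mul_smul r (op (x : A)) t : _)

/-- A consequence of Nakayama's lemma for submodules `I` and `N` of a Noetherian module: if the
quotient of `I` by the sum of `N` and `rad R • I` is a direct sum of copies of `S`, then `I ≤ N`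
as soon as all maps `I → S` are zero. That they are zero is split into the extension of
such maps to the ambient module and the vanishing of these extensions on `I`. -/
lemma le_of_quotient_equiv_finsupp {R : Type u} [Ring R] {E : Type u} [AddCommGroup E] [Module R E]
    [IsNoetherian R E] (I N : Submodule R E) (S : Type u) [AddCommGroup S] [Module R S]
    (hQ : ∃ ι : Type u, Nonempty
      ((I ⧸ (N ⊔ Ring.jacobson R • I).submoduleOf I) ≃ₗ[R] ι →₀ S))
    (hext : ∀ φ : I →ₗ[R] S, ∃ ψ : E →ₗ[R] S, ∀ x : I, ψ x = φ x)
    (hzero : ∀ ψ : E →ₗ[R] S, ∀ x ∈ I, ψ x = 0) : I ≤ N := by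
  have h : I ≤ N ⊔ Ring.jacobson R • I := by
    obtain ⟨ι, ⟨θ⟩⟩ := hQ
    intro x hx
    suffices h0 : θ (Submodule.Quotient.mk ⟨x, hx⟩) = 0 by
      rw [map_eq_zero_iff _ θ.injective, Submodule.Quotient.mk_eq_zero] at h0
      exact h0
    ext i : 1
    obtain ⟨ψ, hψ⟩ := hext (Finsupp.lapply i ∘ₗ θ.toLinearMap ∘ₗ Submodule.mkQ _)
    exact (hψ ⟨x, hx⟩).symm.trans (hzero ψ x hx)
  have h' : I.map N.mkQ = ⊥ := by
    refine Submodule.FG.eq_bot_of_le_jacobson_smul ((IsNoetherian.noetherian I).map _) ?_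
    rw [← Submodule.map_smul'']
    refine (Submodule.map_mono h).trans ?_
    rw [Submodule.map_sup, Submodule.mkQ_map_self, bot_sup_eq]
  rwa [← LinearMap.le_ker_iff_map, Submodule.ker_mkQ] at h'

variable {e : A} (he : IsPrimitiveIdempotent e) (hA : IsSemiperfectRing A) (hb : IsBasicRing A)
  [IsNoetherianRing Aᵐᵒᵖ] (hext : Subsingleton (Ext (simpleTop e) (simpleTop e) 1))

include he hA hb hext

/-- If `Ext¹(S_e, S_e) = 0` then `e rad A` is contained in `eA(1 - e)A`: every map `e rad A → S_e`
extends to `eA`, and hence is zero because the radical kills `S_e`. -/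
lemma submoduleOf_idempotentRad_le_span :
    (idempotentRad e).submoduleOf (idempotentIdeal e) ≤
      Submodule.span Aᵐᵒᵖ (Set.range fun x : idempotentIdeal e ↦ op (1 - e) • x) := by
  have hnoeth : IsNoetherian Aᵐᵒᵖ (idempotentIdeal e) :=
    isNoetherian_of_surjective (LinearMap.toSpanSingleton Aᵐᵒᵖ _ (idempotentGen e)) <|
      LinearMap.range_eq_top.mpr fun x ↦ by
        obtain ⟨a, rfl⟩ := exists_op_smul_idempotentGen x
        exact ⟨op a, rfl⟩
  refine le_of_quotient_equiv_finsupp _ _ (simpleTop e) ?_ ?_ ?_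
  · refine nonempty_linearEquiv_finsupp_simpleTop he hA hb _ (fun t ↦ ?_) (fun j hj t ↦ ?_)
    · obtain ⟨x, rfl⟩ := Submodule.Quotient.mk_surjective _ t
      rw [← Submodule.Quotient.mk_smul, Submodule.Quotient.mk_eq_zero]
      exact Submodule.mem_sup_left (Submodule.subset_span ⟨x, rfl⟩)
    · obtain ⟨x, rfl⟩ := Submodule.Quotient.mk_surjective _ t
      rw [← Submodule.Quotient.mk_smul, Submodule.Quotient.mk_eq_zero]
      exact Submodule.mem_sup_right (Submodule.smul_mem_smul (op_mem_jacobson hj) x.2)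
  · intro φ
    obtain ⟨ψ, hψ⟩ := exists_extension_of_subsingleton_ext_one (simpleTop e)
      (shortExact_of_exact (Submodule.injective_subtype _)
        (LinearMap.exact_subtype_mkQ _) (Submodule.mkQ_surjective _)) hext (ModuleCat.ofHom φ)
    exact ⟨ψ.hom, fun x ↦ congr($(hψ).hom x)⟩
  · rintro ψ x ⟨j, hj, hxj⟩
    have : x = op j • idempotentGen e := Subtype.ext hxj
    rw [this, map_smul, op_smul_simpleTop_of_mem_jacobson he.idem hj]

/-- A module killed by `1 - e` is killed by the radical: `t j` is the image of `e j ∈ eA(1 - e)A`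
under the map `eA → T`, `x ↦ t x`. -/
lemma op_smul_eq_zero_of_mem_jacobson {T : Type u} [AddCommGroup T] [Module Aᵐᵒᵖ T]
    (hT : ∀ t : T, op (1 - e) • t = 0) (j : A) (hj : j ∈ Ring.jacobson A) (t : T) :
    op j • t = 0 := by
  have het : op e • t = t := by
    have := hT t
    rw [MulOpposite.op_sub, sub_smul, MulOpposite.op_one, one_smul, sub_eq_zero] at this
    exact this.symm
  have hmem := submoduleOf_idempotentRad_le_span he hA hb hext
    (show op j • idempotentGen e ∈ _ from ⟨j, hj, rfl⟩)
  have hle : Submodule.span Aᵐᵒᵖ (Set.range fun x : idempotentIdeal e ↦ op (1 - e) • x) ≤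
      LinearMap.ker (idempotentIdealToModule e t) := by
    rw [Submodule.span_le]
    rintro _ ⟨x, rfl⟩
    rw [SetLike.mem_coe, LinearMap.mem_ker, map_smul, hT]
  have h0 : op (e * j) • t = 0 := hle hmem
  rwa [op_mul, mul_smul, het] at h0

/-- The modules killed by `1 - e` are the direct sums of copies of the simple top of `eA`. -/
lemma nonempty_linearEquiv_finsupp_of_op_one_sub_smul (T : Type u) [AddCommGroup T]
    [Module Aᵐᵒᵖ T] (hT : ∀ t : T, op (1 - e) • t = 0) :
    ∃ I : Type u, Nonempty (T ≃ₗ[Aᵐᵒᵖ] I →₀ simpleTop e) :=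
  nonempty_linearEquiv_finsupp_simpleTop he hA hb T hT
    (op_smul_eq_zero_of_mem_jacobson he hA hb hext hT)

/-- The top degree of `Ext(S_e, S_e)` is the top degree of `Ext(T, S_e)` for every nonzero module
`T` killed by `1 - e`. -/
lemma ext_simpleTop_of_op_one_sub_smul (n : ℕ)
    (hn : ∀ i, n < i → Subsingleton (Ext (simpleTop e) (simpleTop e) i))
    (hn' : ¬ Subsingleton (Ext (simpleTop e) (simpleTop e) n)) (T : RightModuleCat A)
    (hT : ∀ t : T, op (1 - e) • t = 0) :
    (∀ i, n < i → Subsingleton (Ext T (simpleTop e) i)) ∧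
      (Subsingleton (Ext T (simpleTop e) n) → Subsingleton T) := by
  obtain ⟨I, ⟨θ⟩⟩ := nonempty_linearEquiv_finsupp_of_op_one_sub_smul he hA hb hext T hT
  refine ⟨fun i hi ↦ ?_, fun h ↦ ?_⟩
  · exact (Retract.ofIso θ.toModuleIso).subsingleton_ext _ _
      (subsingleton_ext_finsupp (simpleTop e) I i (simpleTop e) (hn i hi))
  · by_contra hT0
    have hI : Nonempty I := by
      by_contra hI
      rw [not_nonempty_iff] at hI
      exact hT0 θ.injective.subsingleton
    obtain ⟨i⟩ := hI
    -- `S_e` is a direct summand of `T`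
    let r : Retract (simpleTop e) T :=
      { i := ModuleCat.ofHom (θ.symm.toLinearMap ∘ₗ Finsupp.lsingle i)
        r := ModuleCat.ofHom (Finsupp.lapply i ∘ₗ θ.toLinearMap)
        retract := by
          ext s
          change θ (θ.symm (Finsupp.single i s)) i = s
          rw [θ.apply_symm_apply, Finsupp.single_eq_same] }
    exact hn' (r.subsingleton_ext _ _ h)

end Complementary

/-! ### Self-orthogonality -/

lemma exists_hasProjectiveDimensionLT_of_globalDimension_lt_top {A : Type u} [Ring A]
    (h : globalDimension A < ⊤) :
    ∃ n : ℕ, ∀ M : RightModuleCat A, HasProjectiveDimensionLT M n := by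
  obtain ⟨n, hn⟩ : ∃ n : ℕ, globalDimension A ≤ n := by
    generalize globalDimension A = d at h
    induction d with
    | bot => exact ⟨0, bot_le⟩
    | coe d =>
      induction d with
      | top => exact absurd rfl h.ne
      | coe d => exact ⟨d, le_rfl⟩
  exact ⟨n + 1, fun M ↦ (projectiveDimension_le_iff M n).mp ((le_iSup _ M).trans hn)⟩

/-- The inclusion of a corner ring, on opposite rings. -/
def IsIdempotentElem.cornerOpSubtype {A : Type u} [Ring A] {f : A} (hf : IsIdempotentElem f) :
    hf.Cornerᵐᵒᵖ →ₙ+* Aᵐᵒᵖ :=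
  NonUnitalRingHom.op
    { toFun x := x.1
      map_mul' _ _ := rfl
      map_zero' := rfl
      map_add' _ _ := rfl }

theorem mainTheorem8 {k : Type*} [Field k] [IsAlgClosed k]
    {A : Type u} [Ring A] [Algebra k A]
    [IsNoetherianRing A] [IsNoetherianRing Aᵐᵒᵖ]
    (hA : IsSemiperfectRing A) (hbasic : IsBasicRing A)
    (hfin : Module.Finite k (A ⧸ Ring.jacobson A))
    (e : A) (he : IsPrimitiveIdempotent e)
    (hext : Subsingleton (Abelian.Ext (simpleTop e) (simpleTop e) 1))
    (hgldimA : globalDimension A < ⊤)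
    (hgldimΓ : globalDimension (IdempotentSubalgebra he.idem) < ⊤) :
    IsSelfOrthogonal (simpleTop e) := by
  classical
  obtain ⟨N, hN⟩ := exists_hasProjectiveDimensionLT_of_globalDimension_lt_top hgldimA
  obtain ⟨d, hd⟩ := exists_hasProjectiveDimensionLT_of_globalDimension_lt_top hgldimΓ
  have hbound (i : ℕ) (hi : N ≤ i) : Subsingleton (Abelian.Ext (simpleTop e) (simpleTop e) i) :=
    HasProjectiveDimensionLT.subsingleton (hX := hN (simpleTop e)) _ N i hi _
  have hid : ¬ Subsingleton (Abelian.Ext (simpleTop e) (simpleTop e) 0) := by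
    rw [subsingleton_ext_zero_iff]
    exact fun h ↦ simpleTopGen_ne_zero he (congr($(h LinearMap.id) (simpleTopGen e)))
  -- `n` is the top degree in which `Ext(S_e, S_e)` does not vanish
  let n := Nat.findGreatest
    (fun i ↦ ¬ Subsingleton (Abelian.Ext (simpleTop e) (simpleTop e) i)) N
  have hn' : ¬ Subsingleton (Abelian.Ext (simpleTop e) (simpleTop e) n) :=
    Nat.findGreatest_spec (P := fun i ↦
      ¬ Subsingleton (Abelian.Ext (simpleTop e) (simpleTop e) i)) N.zero_le hid
  have hn (i : ℕ) (hi : n < i) : Subsingleton (Abelian.Ext (simpleTop e) (simpleTop e) i) := by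
    by_cases hiN : i ≤ N
    · exact not_not.mp (Nat.findGreatest_is_greatest hi hiN)
    · exact hbound i (by omega)
  let ι := he.idem.one_sub.cornerOpSubtype
  have hinj : Function.Injective ι := fun x y h ↦
    unop_injective (Subtype.ext (op_injective h))
  have hcorner (r : Aᵐᵒᵖ) : ∃ γ, ι γ = ι 1 * r * ι 1 := by
    refine ⟨op ⟨(1 - e) * r.unop * (1 - e), r.unop, rfl⟩, ?_⟩
    exact congr_arg op (mul_assoc (1 - e) r.unop (1 - e))
  have hproj := projective_idempotentIdeal he.idem
  -- `Ext(eA, S_e)` is nonzero in degree `0` only, which leaves no room for a degree `i ≥ n` unless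
  -- `n = 0`
  have hn0 : n = 0 := by
    rcases ext_eq_zero_or_exists_ge ι hinj hcorner (simpleTop e)
      (op_one_sub_smul_simpleTop he hA hbasic) n
      (ext_simpleTop_of_op_one_sub_smul he hA hbasic hext n hn hn') d
      (ModuleCat.of Aᵐᵒᵖ (idempotentIdeal e)) (hd _) with h | ⟨i, hi, h⟩
    · have h0 := (subsingleton_ext_zero_iff _ _).mp (h 0)
      exact absurd (congr($(h0 (Submodule.mkQ _)) (idempotentGen e))) (simpleTopGen_ne_zero he)
    · cases i with
      | zero => omega
      | succ i => exact absurd (subsingleton_ext_of_projective _ _ i) h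
  exact fun i hi ↦ hn i (by omega)
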